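/- Let $R$ be a commutative ring with unit (for instance a field), let $n\ge 0$, and let $a_1,\dots,a_n$ be nonnegative integers. For a Laurent polynomial $f\in R[z_1^{\pm1},\dots,z_n^{\pm1}]$, let $\mathrm{CT}_{\mathbf z} f\in R$ denote its constant term, that is, the coefficient of the monomial $z_1^0\cdots z_n^0$. Then $$\mathrm{CT}_{\mathbf z}\; \frac{(z_1+\cdots+z_n)^{a_1+\cdots+a_n}}{z_1^{a_1}\cdots z_n^{a_n}}\prod_{1\le i\ne j\le n}\left(1-\frac{z_i}{z_j}\right)^{a_j} = \frac{(a_1+\cdots+a_n)!}{a_1!\,\cdots\,a_n!},$$ where the integer on the right is viewed as an element of $R$. -/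

import Mathlib

namespace DysonLaurent

/-- Laurent polynomials in `z_1, …, z_n` over `R`: finite `R`-linear combinations of the monomials
`z_1 ^ k_1 ⋯ z_n ^ k_n` with `k : Fin n → ℤ`, multiplied by adding exponents. -/
abbrev MvLaurent (n : ℕ) (R : Type*) [Semiring R] : Type _ :=
  AddMonoidAlgebra R (Fin n → ℤ)

/-- The variable `z_i`, as a unit of the ring of Laurent polynomials. Its inverse is the monomial
`z_i⁻¹`. -/
noncomputable def z {n : ℕ} (R : Type*) [CommRing R] (i : Fin n) : (MvLaurent n R)ˣ where
  val := AddMonoidAlgebra.single (Pi.single i 1) 1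
  inv := AddMonoidAlgebra.single (-Pi.single i 1) 1
  val_inv := by
    simp [AddMonoidAlgebra.single_mul_single, AddMonoidAlgebra.one_def]
  inv_val := by
    simp [AddMonoidAlgebra.single_mul_single, AddMonoidAlgebra.one_def]

/-- The constant term of a Laurent polynomial: the coefficient of `z_1 ^ 0 ⋯ z_n ^ 0`. -/
def constTerm {n : ℕ} {R : Type*} [CommRing R] (f : MvLaurent n R) : R :=
  f.coeff 0

end DysonLaurent

/-! This is Good's argument for Dyson's identity. The Laurent polynomial is `∏ F_j ^ a_j`, with `F_j
= dysonFactor`. Lagrange interpolation gives `∑ 1 / F_j = 1`, so when all `a_j` are positive the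
constant terms satisfy Pascal's recursion for multinomials (`prod_dysonFactor_pow_eq_sum`,
`multinomial_eq_sum_update`). If some `a_j = 0`, no negative power of `z_j` occurs; setting `z_j =
0` preserves the constant term and removes the index `j` (`constTerm_prod_dysonFactor_pow_erase`).
-/

namespace DysonLaurent

open Finset

section Lagrange

-- The remainder of `X ^ #s` modulo the nodal polynomial is its own interpolant; compare
-- coefficients of `X ^ (#s - 1)`.
open Polynomial in
theorem sum_pow_card_div_prod_sub {ι F : Type*} [DecidableEq ι] [Field F] (s : Finset ι)
    (v : ι → F) (hv : Set.InjOn v s) :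
    ∑ j ∈ s, v j ^ #s / ∏ i ∈ s.erase j, (v j - v i) = ∑ j ∈ s, v j := by
  rcases s.eq_empty_or_nonempty with rfl | hs
  · simp
  have hdeg : (X ^ #s - Lagrange.nodal s v).degree < (#s : WithBot ℕ) := by
    have h := degree_sub_lt_left (p := X ^ #s) (q := Lagrange.nodal s v)
      (by rw [degree_X_pow, Lagrange.degree_nodal]) (pow_ne_zero _ X_ne_zero)
      (by rw [(Lagrange.nodal_monic).leadingCoeff, (monic_X_pow _).leadingCoeff])
    rwa [degree_X_pow] at h
  have h := Lagrange.coeff_eq_sum hv hdeg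
  rw [coeff_sub, coeff_X_pow, Lagrange.nodal_eq,
    prod_X_sub_C_coeff_card_pred s v hs.card_pos,
    if_neg (by have := hs.card_pos; omega), zero_sub, neg_neg] at h
  rw [h]
  refine sum_congr rfl fun j hj => ?_
  rw [← Lagrange.nodal_eq, eval_sub, Lagrange.eval_nodal_at_node hj, eval_pow, eval_X, sub_zero]

/-- With denominators cleared the identity is universal: it is checked for indeterminates over `ℤ`,
which are distinct in a field, then specialised. -/
theorem sum_pow_card_mul_prod_erase {ι S : Type*} [DecidableEq ι] [CommRing S] (s : Finset ι)
    (x : ι → S) :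
    ∑ j ∈ s, x j ^ #s * ∏ k ∈ s.erase j, ∏ i ∈ s.erase k, (x k - x i)
      = (∑ j ∈ s, x j) * ∏ k ∈ s, ∏ i ∈ s.erase k, (x k - x i) := by
  have generic : ∑ j ∈ s, (MvPolynomial.X j : MvPolynomial ι ℤ) ^ #s *
      ∏ k ∈ s.erase j, ∏ i ∈ s.erase k, (MvPolynomial.X k - MvPolynomial.X i)
      = (∑ j ∈ s, MvPolynomial.X j) *
        ∏ k ∈ s, ∏ i ∈ s.erase k, (MvPolynomial.X k - MvPolynomial.X i) := by
    let K := FractionRing (MvPolynomial ι ℤ)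
    have hinj : Function.Injective (algebraMap (MvPolynomial ι ℤ) K) :=
      IsFractionRing.injective _ _
    apply hinj
    let v : ι → K := fun i => algebraMap (MvPolynomial ι ℤ) K (MvPolynomial.X i)
    have hv : Function.Injective v := hinj.comp (MvPolynomial.X_injective)
    have hne : ∀ k, ∏ i ∈ s.erase k, (v k - v i) ≠ 0 := fun k =>
      prod_ne_zero_iff.2 fun i hi => sub_ne_zero.2 (hv.ne (ne_of_mem_erase hi).symm)
    have h := sum_pow_card_div_prod_sub s v hv.injOn
    simp only [map_sum, map_mul, map_prod, map_pow, map_sub]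
    change ∑ j ∈ s, v j ^ #s * ∏ k ∈ s.erase j, ∏ i ∈ s.erase k, (v k - v i)
      = (∑ j ∈ s, v j) * ∏ k ∈ s, ∏ i ∈ s.erase k, (v k - v i)
    rw [← h, sum_mul]
    refine sum_congr rfl fun j hj => ?_
    rw [← mul_prod_erase s _ hj, ← mul_assoc, div_mul_cancel₀ _ (hne j)]
  simpa using congrArg (MvPolynomial.aeval x) generic

end Lagrange

section Factor

variable {ι S : Type*} [DecidableEq ι] [CommRing S]

/-- The factor `(∑ i ∈ s, u i) / u j * ∏ i ∈ s \ {j}, (1 - u i / u j)`. The Laurent polynomial of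
the theorem is the product of the powers `dysonFactor u s j ^ a j`. -/
def dysonFactor (u : ι → Sˣ) (s : Finset ι) (j : ι) : S :=
  (∑ i ∈ s, (u i : S)) * ((u j)⁻¹ : Sˣ) * ∏ i ∈ s.erase j, (1 - ((u i / u j : Sˣ) : S))

theorem dysonFactor_mul_pow_card (u : ι → Sˣ) {s : Finset ι} {j : ι} (hj : j ∈ s) :
    dysonFactor u s j * (u j : S) ^ #s
      = (∑ i ∈ s, (u i : S)) * ∏ i ∈ s.erase j, ((u j : S) - u i) := by
  have h : ∏ i ∈ s.erase j, ((u j : S) - u i)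
      = (∏ i ∈ s.erase j, (1 - ((u i / u j : Sˣ) : S))) * (u j : S) ^ #(s.erase j) := by
    rw [← prod_const, ← prod_mul_distrib]
    refine prod_congr rfl fun i _ => ?_
    rw [sub_mul, one_mul, ← Units.val_mul, div_mul_cancel]
  rw [h, dysonFactor, ← card_erase_add_one hj, pow_succ]
  linear_combination (∑ i ∈ s, (u i : S)) * (∏ i ∈ s.erase j, (1 - ((u i / u j : Sˣ) : S)))
    * (u j : S) ^ #(s.erase j) * Units.inv_mul (u j)

/-- The reciprocals of the factors sum to one. -/
theorem sum_prod_erase_dysonFactor (u : ι → Sˣ) {s : Finset ι} (hs : s.Nonempty) :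
    ∑ j ∈ s, ∏ k ∈ s.erase j, dysonFactor u s k = ∏ k ∈ s, dysonFactor u s k := by
  have hunit : IsUnit (∏ k ∈ s, (u k : S) ^ #s) := by
    simpa using (∏ k ∈ s, u k ^ #s).isUnit
  apply hunit.mul_left_injective
  set e : S := ∑ i ∈ s, (u i : S) with he
  have hr : (∏ k ∈ s, dysonFactor u s k) * ∏ k ∈ s, (u k : S) ^ #s
      = e ^ #s * ∏ k ∈ s, ∏ i ∈ s.erase k, ((u k : S) - u i) := by
    rw [← prod_mul_distrib, prod_congr rfl fun k hk => dysonFactor_mul_pow_card u hk,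
      prod_mul_distrib, prod_const]
  -- Omitting the factor `j` costs one `e` and leaves `u j ^ #s` unabsorbed.
  have hl : ∀ j ∈ s, (∏ k ∈ s.erase j, dysonFactor u s k) * ∏ k ∈ s, (u k : S) ^ #s
      = e ^ (#s - 1) *
        ((u j : S) ^ #s * ∏ k ∈ s.erase j, ∏ i ∈ s.erase k, ((u k : S) - u i)) := by
    intro j hj
    rw [← mul_prod_erase s _ hj, mul_left_comm, ← prod_mul_distrib,
      prod_congr rfl fun k hk => dysonFactor_mul_pow_card u (mem_of_mem_erase hk),
      prod_mul_distrib, prod_const, card_erase_of_mem hj]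
    ring
  change _ * _ = _ * _
  rw [hr, sum_mul, sum_congr rfl hl, ← mul_sum, sum_pow_card_mul_prod_erase, ← mul_assoc,
    ← pow_succ, Nat.sub_add_cancel hs.card_pos]

theorem prod_dysonFactor_pow_eq_sum (u : ι → Sˣ) {s : Finset ι} (hs : s.Nonempty) (a : ι → ℕ)
    (ha : ∀ j ∈ s, a j ≠ 0) :
    ∏ k ∈ s, dysonFactor u s k ^ a k
      = ∑ j ∈ s, ∏ k ∈ s, dysonFactor u s k ^ Function.update a j (a j - 1) k := by
  have h1 : ∏ k ∈ s, dysonFactor u s k ^ a k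
      = (∏ k ∈ s, dysonFactor u s k ^ (a k - 1)) * ∏ k ∈ s, dysonFactor u s k := by
    rw [← prod_mul_distrib]
    refine prod_congr rfl fun k hk => ?_
    rw [← pow_succ, Nat.sub_add_cancel (Nat.pos_of_ne_zero (ha k hk))]
  rw [h1, ← sum_prod_erase_dysonFactor u hs, mul_sum]
  refine sum_congr rfl fun j hj => ?_
  rw [← mul_prod_erase s _ hj, ← mul_prod_erase s (fun k => _ ^ Function.update a j _ k) hj,
    mul_assoc, ← prod_mul_distrib, Function.update_self]
  congr 1
  refine prod_congr rfl fun k hk => ?_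
  rw [Function.update_of_ne (ne_of_mem_erase hk), ← pow_succ,
    Nat.sub_add_cancel (Nat.pos_of_ne_zero (ha k (mem_of_mem_erase hk)))]

end Factor

theorem sum_update_pred_add_one {ι : Type*} [DecidableEq ι] {s : Finset ι} {a : ι → ℕ} {j : ι}
    (hj : j ∈ s) (ha : a j ≠ 0) :
    ∑ i ∈ s, Function.update a j (a j - 1) i + 1 = ∑ i ∈ s, a i := by
  rw [sum_update_of_mem hj, sdiff_singleton_eq_erase, ← add_sum_erase s a hj]
  omega

/-- Multiplied by `∏ (a i)!`, the `j`-th term is `a j * (∑ a - 1)!`, and these add up to `(∑ a)!`.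
-/
theorem multinomial_eq_sum_update {ι : Type*} [DecidableEq ι] {s : Finset ι} (hs : s.Nonempty)
    (a : ι → ℕ) (ha : ∀ j ∈ s, a j ≠ 0) :
    Nat.multinomial s a
      = ∑ j ∈ s, Nat.multinomial s (Function.update a j (a j - 1)) := by
  apply Nat.eq_of_mul_eq_mul_left (prod_pos fun i (_ : i ∈ s) => Nat.factorial_pos (a i))
  rw [Nat.multinomial_spec, mul_sum]
  have key : ∀ j ∈ s, (∏ i ∈ s, (a i).factorial)
      * Nat.multinomial s (Function.update a j (a j - 1))
      = a j * (∑ i ∈ s, a i - 1).factorial := by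
    intro j hj
    have hsum : ∑ i ∈ s, Function.update a j (a j - 1) i = ∑ i ∈ s, a i - 1 := by
      rw [← sum_update_pred_add_one hj (ha j hj), Nat.add_sub_cancel]
    have hprod : ∏ i ∈ s, (a i).factorial
        = a j * ∏ i ∈ s, (Function.update a j (a j - 1) i).factorial := by
      rw [← mul_prod_erase s _ hj,
        ← mul_prod_erase s (fun i => (Function.update a j _ i).factorial) hj,
        Function.update_self, ← mul_assoc, Nat.mul_factorial_pred (ha j hj)]
      congr 1
      refine prod_congr rfl fun i hi => ?_
      rw [Function.update_of_ne (ne_of_mem_erase hi)]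
    rw [hprod, mul_assoc, Nat.multinomial_spec, hsum]
  rw [sum_congr rfl key, ← sum_mul, Nat.mul_factorial_pred]
  obtain ⟨j, hj⟩ := hs
  exact (sum_pos' (fun _ _ => Nat.zero_le _) ⟨j, hj, Nat.pos_of_ne_zero (ha j hj)⟩).ne'

section ConstantTerm

variable {n : ℕ} {R : Type*} [CommRing R]

/-- The Laurent polynomials in which `z_j` occurs with nonnegative exponents only. -/
def nonnegSubring (R : Type*) [CommRing R] (j : Fin n) : Subring (MvLaurent n R) where
  carrier := {f | ∀ k, f.coeff k ≠ 0 → 0 ≤ k j}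
  mul_mem' {f g} hf hg k hk := by
    classical
    have h := AddMonoidAlgebra.support_coeff_mul_subset f g (Finsupp.mem_support_iff.2 hk)
    obtain ⟨p, hp, q, hq, rfl⟩ := mem_add.1 h
    exact add_nonneg (hf p (Finsupp.mem_support_iff.1 hp)) (hg q (Finsupp.mem_support_iff.1 hq))
  one_mem' k hk := by
    classical
    rw [AddMonoidAlgebra.one_def, AddMonoidAlgebra.coeff_single, Finsupp.single_apply] at hk
    split_ifs at hk with h
    · simp [← h]
    · simp at hk
  add_mem' {f g} hf hg k hk := by
    by_cases h : f.coeff k = 0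
    · exact hg k fun h' => hk (by simp [h, h'])
    · exact hf k h
  zero_mem' k hk := by simp at hk
  neg_mem' {f} hf k hk := hf k (by simpa using hk)

theorem z_mem_nonnegSubring (i j : Fin n) : (z R i : MvLaurent n R) ∈ nonnegSubring R j := by
  intro k hk
  change (AddMonoidAlgebra.single _ _ : MvLaurent n R).coeff k ≠ 0 at hk
  rw [AddMonoidAlgebra.coeff_single, Finsupp.single_apply] at hk
  split_ifs at hk with h
  · rw [← h, Pi.single_apply]
    split_ifs <;> simp
  · simp at hk

theorem inv_z_mem_nonnegSubring {i j : Fin n} (hij : i ≠ j) :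
    (((z R i)⁻¹ : (MvLaurent n R)ˣ) : MvLaurent n R) ∈ nonnegSubring R j := by
  intro k hk
  change (AddMonoidAlgebra.single _ _ : MvLaurent n R).coeff k ≠ 0 at hk
  rw [AddMonoidAlgebra.coeff_single, Finsupp.single_apply] at hk
  split_ifs at hk with h
  · simp [← h, hij.symm]
  · simp at hk

theorem constTerm_z_mul {j : Fin n} {f : MvLaurent n R} (hf : f ∈ nonnegSubring R j) :
    constTerm ((z R j : MvLaurent n R) * f) = 0 := by
  change ((AddMonoidAlgebra.single (Pi.single j 1) 1 : MvLaurent n R) * f).coeff 0 = 0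
  rw [AddMonoidAlgebra.coeff_single_mul_apply, one_mul]
  by_contra h
  -- The coefficient in question is that of `f` at an exponent with `j`-th entry `-1`.
  simpa using hf _ h

/-- `f` and `g` agree after setting `z_j = 0`, with `z_j` occurring in both with nonnegative
exponents only. -/
def EqAtZero (j : Fin n) (f g : MvLaurent n R) : Prop :=
  g ∈ nonnegSubring R j ∧ ∃ h ∈ nonnegSubring R j, f = g + z R j * h

theorem EqAtZero.constTerm_eq {j : Fin n} {f g : MvLaurent n R} (h : EqAtZero j f g) :
    constTerm f = constTerm g := by
  obtain ⟨-, h, hh, rfl⟩ := h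
  have := constTerm_z_mul hh
  simp only [constTerm, AddMonoidAlgebra.coeff_add, Finsupp.add_apply] at this ⊢
  rw [this, add_zero]

theorem EqAtZero.refl {j : Fin n} {f : MvLaurent n R} (hf : f ∈ nonnegSubring R j) :
    EqAtZero j f f :=
  ⟨hf, 0, zero_mem _, by simp⟩

theorem EqAtZero.mul {j : Fin n} {f g f' g' : MvLaurent n R} (h : EqAtZero j f g)
    (h' : EqAtZero j f' g') : EqAtZero j (f * f') (g * g') := by
  obtain ⟨hg, p, hp, rfl⟩ := h
  obtain ⟨hg', q, hq, rfl⟩ := h'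
  exact ⟨mul_mem hg hg', g * q + p * g' + z R j * (p * q),
    add_mem (add_mem (mul_mem hg hq) (mul_mem hp hg'))
      (mul_mem (z_mem_nonnegSubring j j) (mul_mem hp hq)), by ring⟩

theorem EqAtZero.pow {j : Fin n} {f g : MvLaurent n R} (h : EqAtZero j f g) (m : ℕ) :
    EqAtZero j (f ^ m) (g ^ m) := by
  induction m with
  | zero => simpa using EqAtZero.refl (one_mem (nonnegSubring R j))
  | succ m ih => simpa [pow_succ] using ih.mul h

theorem EqAtZero.prod {ι : Type*} {j : Fin n} {s : Finset ι} {f g : ι → MvLaurent n R}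
    (h : ∀ i ∈ s, EqAtZero j (f i) (g i)) : EqAtZero j (∏ i ∈ s, f i) (∏ i ∈ s, g i) := by
  classical
  induction s using Finset.induction_on with
  | empty => simpa using EqAtZero.refl (one_mem (nonnegSubring R j))
  | insert i s hi ih =>
    rw [prod_insert hi, prod_insert hi]
    exact (h i (mem_insert_self i s)).mul (ih fun k hk => h k (mem_insert_of_mem hk))

/-- For `k ≠ j`, `z_j` appears only in numerators: in the sum, and in `1 - z_j / z_k`, which becomes
`1`. -/
theorem eqAtZero_dysonFactor {s : Finset (Fin n)} {j k : Fin n} (hj : j ∈ s)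
    (hk : k ∈ s.erase j) :
    EqAtZero j (dysonFactor (z R) s k) (dysonFactor (z R) (s.erase j) k) := by
  have hkj := ne_of_mem_erase hk
  have hinv := inv_z_mem_nonnegSubring (R := R) hkj
  have hdiv : ∀ i, ((z R i / z R k : (MvLaurent n R)ˣ) : MvLaurent n R)
      ∈ nonnegSubring R j := fun i => by
    rw [div_eq_mul_inv, Units.val_mul]
    exact mul_mem (z_mem_nonnegSubring i j) hinv
  have hjk : j ∈ s.erase k := mem_erase.2 ⟨hkj.symm, hj⟩
  have hsum : EqAtZero j (∑ i ∈ s, (z R i : MvLaurent n R))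
      (∑ i ∈ s.erase j, (z R i : MvLaurent n R)) :=
    ⟨sum_mem fun i _ => z_mem_nonnegSubring i j, 1, one_mem _, by
      rw [mul_one, sum_erase_add _ _ hj]⟩
  have hlin : EqAtZero j (1 - ((z R j / z R k : (MvLaurent n R)ˣ) : MvLaurent n R)) 1 :=
    ⟨one_mem _, -(((z R k)⁻¹ : (MvLaurent n R)ˣ) : MvLaurent n R), neg_mem hinv, by
      rw [div_eq_mul_inv, Units.val_mul]; ring⟩
  have hprod : EqAtZero j
      (∏ i ∈ s.erase k, (1 - ((z R i / z R k : (MvLaurent n R)ˣ) : MvLaurent n R)))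
      (∏ i ∈ (s.erase j).erase k, (1 - ((z R i / z R k : (MvLaurent n R)ˣ) : MvLaurent n R))) := by
    rw [← mul_prod_erase _ _ hjk, erase_right_comm]
    simpa only [one_mul] using hlin.mul <| EqAtZero.refl <| prod_mem fun i _ => sub_mem (one_mem _) (hdiv i)
  exact (hsum.mul (EqAtZero.refl hinv)).mul hprod

theorem constTerm_prod_dysonFactor_pow_erase {s : Finset (Fin n)} {j : Fin n} (hj : j ∈ s)
    (a : Fin n → ℕ) (ha : a j = 0) :
    constTerm (∏ k ∈ s, dysonFactor (z R) s k ^ a k)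
      = constTerm (∏ k ∈ s.erase j, dysonFactor (z R) (s.erase j) k ^ a k) := by
  rw [← mul_prod_erase s _ hj, ha, pow_zero, one_mul]
  exact (EqAtZero.prod fun k hk => (eqAtZero_dysonFactor hj hk).pow (a k)).constTerm_eq

theorem constTerm_sum {ι : Type*} (s : Finset ι) (f : ι → MvLaurent n R) :
    constTerm (∑ i ∈ s, f i) = ∑ i ∈ s, constTerm (f i) := by
  simp [constTerm]

theorem constTerm_prod_dysonFactor_pow (s : Finset (Fin n)) (a : Fin n → ℕ) :
    constTerm (∏ k ∈ s, dysonFactor (z R) s k ^ a k) = (Nat.multinomial s a : R) := by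
  -- Both removing an index and lowering an exponent decrease this measure.
  induction hm : #s + ∑ i ∈ s, a i using Nat.strong_induction_on generalizing s a with
  | _ m ih =>
    rcases s.eq_empty_or_nonempty with rfl | hs
    · simp [constTerm, AddMonoidAlgebra.one_def]
    by_cases h : ∃ j ∈ s, a j = 0
    · obtain ⟨j, hj, ha⟩ := h
      have hmult : Nat.multinomial s a = Nat.multinomial (s.erase j) a := by
        conv_lhs => rw [← insert_erase hj, Nat.multinomial_insert (notMem_erase j s), ha]
        simp
      rw [constTerm_prod_dysonFactor_pow_erase hj a ha, hmult]
      refine ih _ ?_ _ _ rfl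
      rw [← hm, ← add_sum_erase s a hj, card_erase_of_mem hj]
      have := card_pos.2 hs
      omega
    · push Not at h
      rw [prod_dysonFactor_pow_eq_sum _ hs a h, constTerm_sum, multinomial_eq_sum_update hs a h,
        Nat.cast_sum]
      refine sum_congr rfl fun j hj => ih _ ?_ _ _ rfl
      have := sum_update_pred_add_one hj (h j hj)
      omega

end ConstantTerm

end DysonLaurent

theorem mainTheorem5 {R : Type*} [CommRing R] (n : ℕ) (a : Fin n → ℕ) :
    DysonLaurent.constTerm
      ((∑ i : Fin n, (DysonLaurent.z R i : DysonLaurent.MvLaurent n R)) ^ (∑ i, a i)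
        * (((∏ i : Fin n, DysonLaurent.z R i ^ a i)⁻¹ : (DysonLaurent.MvLaurent n R)ˣ) :
            DysonLaurent.MvLaurent n R)
        * ∏ j : Fin n, ∏ i ∈ Finset.univ.erase j,
            (1 - ((DysonLaurent.z R i / DysonLaurent.z R j : (DysonLaurent.MvLaurent n R)ˣ) :
              DysonLaurent.MvLaurent n R)) ^ a j)
      = (Nat.multinomial Finset.univ a : R) := by
  rw [← DysonLaurent.constTerm_prod_dysonFactor_pow]
  congr 1
  simp only [DysonLaurent.dysonFactor, mul_pow, Finset.prod_mul_distrib, Finset.prod_pow_eq_pow_sum,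
    Finset.prod_pow, ← Finset.prod_inv_distrib, ← inv_pow, Units.coe_prod, Units.val_pow_eq_pow_val]
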